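/- Let $N$ be a von Neumann algebra acting on a complex Hilbert space which is a factor, i.e. whose center is $\mathbb{C}1$. Let $Inv(N)=\{u\in N : u^2=1\}$ be the set of involutions in $N$. For an idempotent $e\in N$ (i.e. $e^2=e$) put $$\Delta^+(e)=\{2f-1 : f\in N,\ f^2=f,\ fN=eN\},\qquad \Delta^-(e)=-\Delta^+(e)=\{-u : u\in\Delta^+(e)\}.$$ A set $\phi\subseteq N$ is called a $\Delta^+$-set (respectively a $\Delta^-$-set) if $\phi=\Delta^+(e)$ (respectively $\phi=\Delta^-(e)$) for some idempotent $e\in N$. Let $\phi$ be a nonempty subset of $Inv(N)$. Then $\phi$ is a $\Delta^+$-set or a $\Delta^-$-set if and only if $\phi$ is maximal, with respect to inclusion, among the nonempty subsets of $Inv(N)$ which satisfy the following four conditions (stated for $\phi$): \begin{enumerate} \item If $u,v,w\in\phi$, then $uvw=wvu$ and $uvw\in\phi$. \item If $u,v\in\phi$, then there exists a unique $w\in\phi$ such that $wvw=u$. \item For every $u\in Inv(N)$: $u\phi=\phi u$ (equality of the sets $\{uw : w\in\phi\}$ and $\{wu : w\in\phi\}$) if and only if $uw=wu$ for some $w\in\phi$.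 \item If $t=uv$ with $u,v\in\phi$, then $(t-1)^2=0$. \end{enumerate} -/

import Mathlib

/-- A von Neumann algebra `N` of bounded operators on a complex Hilbert space is a *factor* if its
center `N ∩ N'` consists of the scalar operators only. -/
def VonNeumannAlgebra.IsFactor {H : Type*} [NormedAddCommGroup H] [InnerProductSpace ℂ H]
    [CompleteSpace H] (N : VonNeumannAlgebra H) : Prop :=
  ∀ z : H →L[ℂ] H, z ∈ N → z ∈ N.commutant → ∃ c : ℂ, z = c • (1 : H →L[ℂ] H)

namespace DeltaSets

section

variable {R : Type*} [Ring R]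

/-- The set of involutions `Inv(R)`: elements with `u² = 1` (the identity is included). -/
def involutions (R : Type*) [Ring R] : Set R := {u | u ^ 2 = 1}

/-- The principal right ideal `eR`, as a set. -/
def rightIdeal (e : R) : Set R := {y | ∃ x : R, y = e * x}

/-- The class `[e]`: all idempotents generating the same right ideal as `e`. -/
def idemClass (e : R) : Set R := {f | IsIdempotentElem f ∧ rightIdeal f = rightIdeal e}

/-- `Δ⁺(e) = {2f - 1 : f ∈ [e]}`. -/
def deltaPlus (e : R) : Set R := (fun f : R => 2 * f - 1) '' idemClass e

/-- `Δ⁻(e) = -Δ⁺(e)`. -/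
def deltaMinus (e : R) : Set R := (fun u : R => -u) '' deltaPlus e

/-- `φ` is a `Δ⁺`-set: `φ = Δ⁺(e)` for some idempotent `e`. -/
def IsDeltaPlusSet (φ : Set R) : Prop := ∃ e : R, IsIdempotentElem e ∧ φ = deltaPlus e

/-- `φ` is a `Δ⁻`-set: `φ = Δ⁻(e)` for some idempotent `e`. -/
def IsDeltaMinusSet (φ : Set R) : Prop := ∃ e : R, IsIdempotentElem e ∧ φ = deltaMinus e

/-- `φ² = {uv : u, v ∈ φ}`. -/
def setSq (φ : Set R) : Set R := {t | ∃ u ∈ φ, ∃ v ∈ φ, t = u * v}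

/-- The four conditions on a set `φ` of involutions. -/
structure FourConditions (φ : Set R) : Prop where
  triple : ∀ u ∈ φ, ∀ v ∈ φ, ∀ w ∈ φ, u * v * w = w * v * u ∧ u * v * w ∈ φ
  midpoint : ∀ u ∈ φ, ∀ v ∈ φ, ∃! w : R, w ∈ φ ∧ w * v * w = u
  normalise : ∀ u ∈ involutions R,
    ((fun w : R => u * w) '' φ = (fun w : R => w * u) '' φ ↔ ∃ w ∈ φ, u * w = w * u)
  square : ∀ t ∈ setSq φ, (t - 1) ^ 2 = 0

end

end DeltaSets

/-! Fix an idempotent `e`. Then `Δ⁺(e)` is the affine space `2e - 1 + eR(1 - e)`, and any two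
deviations in `eR(1 - e)` multiply to zero. Triple products therefore become `n - m + k` and
midpoints become averages, which gives the four conditions (`fourConditions_deltaPlus`).

Conversely, let `φ` be admissible with base point `2e - 1`. Unipotence makes every deviation
off-diagonal for `e`, the triple condition makes products of deviations vanish, and the normaliser
condition allows conjugation by involutions commuting with `2e - 1`. Together with primeness this
forces all deviations into one corner, `eR(1 - e)` or `(1 - e)Re` (`IsAdmissible.left_or_right`), so
`φ` lies in a `Δ⁺`- or `Δ⁻`-set.

Primeness also shows that nothing admissible properly contains `Δ⁺(e)`. A factor enters only through
primeness and range projections. -/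

namespace DeltaSets

/-! ### `Δ⁺`-sets as affine spaces of involutions. -/

section Abstract

variable {R : Type*} [Ring R]

lemma mem_idemClass_iff {e f : R} (he : IsIdempotentElem e) :
    f ∈ idemClass e ↔ e * f = f ∧ f * e = e := by
  constructor
  · rintro ⟨hf, h⟩
    have h1 : f ∈ rightIdeal e := h ▸ ⟨f, hf.eq.symm⟩
    have h2 : e ∈ rightIdeal f := h ▸ ⟨e, he.eq.symm⟩
    obtain ⟨x, hx⟩ := h1
    obtain ⟨y, hy⟩ := h2
    constructor
    · nth_rw 1 [hx]; rw [← mul_assoc, he.eq, ← hx]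
    · nth_rw 1 [hy]; rw [← mul_assoc, hf.eq, ← hy]
  · rintro ⟨h1, h2⟩
    refine ⟨?_, ?_⟩
    · change f * f = f
      nth_rw 2 [← h1]; rw [← mul_assoc, h2, h1]
    · ext y
      constructor
      · rintro ⟨x, rfl⟩
        exact ⟨f * x, by rw [← mul_assoc, h1]⟩
      · rintro ⟨x, rfl⟩
        exact ⟨e * x, by rw [← mul_assoc, h2]⟩

/-- Halving the deviation `n` from `2e - 1` recovers the idempotent `e + n/2`; this is where
rational scalars enter. -/
lemma mem_deltaPlus_iff [Algebra ℚ R] {e u : R} (he : IsIdempotentElem e) :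
    u ∈ deltaPlus e ↔ e * (u - (2 * e - 1)) = u - (2 * e - 1) ∧ (u - (2 * e - 1)) * e = 0 := by
  have hee : e * e = e := he
  constructor
  · rintro ⟨f, hf, rfl⟩
    rw [mem_idemClass_iff he] at hf
    obtain ⟨h1, h2⟩ := hf
    have : 2 * f - 1 - (2 * e - 1) = (f - e) + (f - e) := by noncomm_ring
    simp only [this, mul_add, add_mul, mul_sub, sub_mul, h1, h2, hee, sub_self, add_zero,
      and_self]
  · rintro ⟨h1, h2⟩
    obtain ⟨n, hn⟩ : ∃ n, u - (2 * e - 1) = n := ⟨_, rfl⟩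
    rw [hn] at h1 h2
    refine ⟨e + (1 / 2 : ℚ) • n, (mem_idemClass_iff he).2 ⟨?_, ?_⟩, ?_⟩
    · rw [mul_add, mul_smul_comm, h1, hee]
    · rw [add_mul, smul_mul_assoc, h2, hee, smul_zero, add_zero]
    · have : u = 2 * e - 1 + n := by rw [← hn]; abel
      rw [this]
      simp only [two_mul]
      module

lemma mem_neg_image {φ : Set R} {u : R} : u ∈ (fun x : R => -x) '' φ ↔ -u ∈ φ := by
  simp

/-- Recentring: any point of the affine space can serve as its base point. -/
lemma exists_idempotent_of_mem_deltaPlus {e w : R} (hw : w ∈ deltaPlus e) :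
    ∃ f : R, IsIdempotentElem f ∧ w = 2 * f - 1 ∧ deltaPlus e = deltaPlus f := by
  obtain ⟨f, hf, rfl⟩ := hw
  refine ⟨f, hf.1, rfl, ?_⟩
  unfold deltaPlus idemClass
  rw [hf.2]

lemma mul_self_of_mem_involutions {u : R} (hu : u ∈ involutions R) : u * u = 1 := by
  rw [← sq]; exact hu

lemma involution_cancel {u : R} (hu : u * u = 1) (x : R) : u * (u * x) = x := by
  rw [← mul_assoc, hu, one_mul]

/-- For involutions `u, v`, unipotence of `u * v` of degree two is a linear relation. -/
lemma mul_sub_one_sq_eq_zero_iff {u v : R} (hu : u * u = 1) (hv : v * v = 1) :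
    (u * v - 1) ^ 2 = 0 ↔ u * v + v * u = 2 := by
  have key : v * u * (u * v - 1) ^ 2 = u * v + v * u - 2 := by
    have : v * u * (u * v - 1) ^ 2 =
        v * (u * u) * v * u * v - 2 * (v * (u * u) * v) + v * u := by noncomm_ring
    rw [this, hu, mul_one, hv, one_mul, mul_one]
    abel
  constructor
  · intro h
    rw [h, mul_zero] at key
    exact (sub_eq_zero.1 key.symm)
  · intro h
    rw [h, sub_self] at key
    have := congrArg (fun x => u * (v * x)) key
    simpa only [mul_zero, mul_assoc, involution_cancel hu, involution_cancel hv] using this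

lemma deltaPlus_subset_involutions {e : R} : deltaPlus e ⊆ involutions R := by
  rintro _ ⟨f, hf, rfl⟩
  have hff : f * f = f := hf.1
  have : (2 * f - 1) ^ 2 = 4 * (f * f) - 4 * f + 1 := by noncomm_ring
  change (2 * f - 1) ^ 2 = 1
  rw [this, hff]; noncomm_ring

lemma self_mem_deltaPlus {e : R} (he : IsIdempotentElem e) : 2 * e - 1 ∈ deltaPlus e :=
  ⟨e, ⟨he, rfl⟩, rfl⟩

section Deviation

/-! Products of elements `2 * e - 1 + n` with `e * n = n` and `n * e = 0`. -/

variable {e n m : R}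

lemma deviation_mul_eq_zero (hn : n * e = 0) (hm : e * m = m) : n * m = 0 := by
  rw [← hm, ← mul_assoc, hn, zero_mul]

lemma deviation_mul (he : IsIdempotentElem e) (hn' : n * e = 0) (hm : e * m = m) :
    (2 * e - 1 + n) * (2 * e - 1 + m) = 1 + (m - n) := by
  have hee : e * e = e := he
  have : (2 * e - 1 + n) * (2 * e - 1 + m) =
      4 * (e * e) - 4 * e + 1 + 2 * (e * m) - m + 2 * (n * e) - n + n * m := by noncomm_ring
  rw [this, hee, hm, hn', deviation_mul_eq_zero hn' hm]
  noncomm_ring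

lemma deviation_triple {k : R} (he : IsIdempotentElem e) (hn' : n * e = 0)
    (hm : e * m = m) (hm' : m * e = 0) (hk : e * k = k) :
    (2 * e - 1 + n) * (2 * e - 1 + m) * (2 * e - 1 + k) = 2 * e - 1 + (n - m + k) := by
  rw [deviation_mul he hn' hm]
  have : (1 + (m - n)) * (2 * e - 1 + k) =
      2 * e - 1 + k + 2 * (m * e) - 2 * (n * e) - m + n + m * k - n * k := by noncomm_ring
  rw [this, hn', hm', deviation_mul_eq_zero hn' hk, deviation_mul_eq_zero hm' hk]
  noncomm_ring

end Deviation

lemma exists_deviation [Algebra ℚ R] {e u : R} (he : IsIdempotentElem e) (hu : u ∈ deltaPlus e) :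
    ∃ n, e * n = n ∧ n * e = 0 ∧ u = 2 * e - 1 + n :=
  ⟨_, ((mem_deltaPlus_iff he).1 hu).1, ((mem_deltaPlus_iff he).1 hu).2, by abel⟩

lemma add_mem_deltaPlus [Algebra ℚ R] {e n : R} (he : IsIdempotentElem e) (h : e * n = n)
    (h' : n * e = 0) : 2 * e - 1 + n ∈ deltaPlus e := by
  rw [mem_deltaPlus_iff he, add_sub_cancel_left]
  exact ⟨h, h'⟩

/-- Recentred at `w = 2f - 1`, the involution `u` commutes with `f`, so conjugation by `u` preserves
the corner `fR(1 - f)`. -/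
lemma conj_mem_deltaPlus [Algebra ℚ R] {e u v w : R} (hu : u * u = 1) (hw : w ∈ deltaPlus e)
    (huw : u * w = w * u) (hv : v ∈ deltaPlus e) : u * v * u ∈ deltaPlus e := by
  obtain ⟨f, hf, rfl, h⟩ := exists_idempotent_of_mem_deltaPlus hw
  rw [h] at hv ⊢
  have huf : u * f = f * u := by
    have h2 : (2 : ℚ) • (u * f) = (2 : ℚ) • (f * u) := by
      have := congrArg (· + u) huw
      simp only [mul_sub, sub_mul, two_mul, mul_add, add_mul, mul_one, one_mul,
        sub_add_cancel] at this
      simpa only [two_smul] using this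
    have := congrArg (fun x => (1 / 2 : ℚ) • x) h2
    simpa [smul_smul] using this
  obtain ⟨n, hn, hn', rfl⟩ := exists_deviation hf hv
  have : u * (2 * f - 1 + n) * u = 2 * f - 1 + u * n * u := by
    have : u * (2 * f - 1 + n) * u = 2 * (u * f * u) - u * u + u * n * u := by noncomm_ring
    rw [this, huf, mul_assoc f, hu, mul_one]
  rw [this]
  refine add_mem_deltaPlus hf ?_ ?_
  · rw [← mul_assoc, ← mul_assoc, ← huf, mul_assoc u, hn]
  · rw [mul_assoc, huf, ← mul_assoc, mul_assoc u, hn', mul_zero, zero_mul]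

lemma fourConditions_deltaPlus [Algebra ℚ R] {e : R} (he : IsIdempotentElem e) :
    FourConditions (deltaPlus e) where
  triple := by
    intro u hu v hv w hw
    obtain ⟨n, hn, hn', rfl⟩ := exists_deviation he hu
    obtain ⟨m, hm, hm', rfl⟩ := exists_deviation he hv
    obtain ⟨k, hk, hk', rfl⟩ := exists_deviation he hw
    rw [deviation_triple he hn' hm hm' hk, deviation_triple he hk' hm hm' hn]
    refine ⟨by abel, add_mem_deltaPlus he ?_ ?_⟩
    · rw [mul_add, mul_sub, hn, hm, hk]
    · rw [add_mul, sub_mul, hn', hm', hk']; simp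
  midpoint := by
    intro u hu v hv
    obtain ⟨n, hn, hn', rfl⟩ := exists_deviation he hu
    obtain ⟨m, hm, hm', rfl⟩ := exists_deviation he hv
    -- In terms of deviations the equation `wvw = u` reads `k - m + k = n`.
    refine ⟨2 * e - 1 + (1 / 2 : ℚ) • (n + m), ⟨?_, ?_⟩, ?_⟩
    · refine add_mem_deltaPlus he ?_ ?_
      · rw [mul_smul_comm, mul_add, hn, hm]
      · rw [smul_mul_assoc, add_mul, hn', hm', add_zero, smul_zero]
    · rw [deviation_triple he ?_ hm hm' ?_]
      · module
      · rw [smul_mul_assoc, add_mul, hn', hm', add_zero, smul_zero]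
      · rw [mul_smul_comm, mul_add, hn, hm]
    · rintro w ⟨hw, h⟩
      obtain ⟨k, hk, hk', rfl⟩ := exists_deviation he hw
      rw [deviation_triple he hk' hm hm' hk, add_right_inj] at h
      rw [← h]
      module
  normalise := by
    intro u hu
    have huu := mul_self_of_mem_involutions hu
    constructor
    · intro h
      have : u * (2 * e - 1) ∈ (fun w : R => w * u) '' deltaPlus e :=
        h ▸ ⟨_, self_mem_deltaPlus he, rfl⟩
      obtain ⟨w, hw, hwu⟩ := this
      obtain ⟨n, hn, hn', rfl⟩ := exists_deviation he hw
      -- Conjugation by `u` swaps `2e - 1` and `2e - 1 + n`, hence fixes their midpoint.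
      refine ⟨2 * e - 1 + (1 / 2 : ℚ) • n, add_mem_deltaPlus he ?_ ?_, ?_⟩
      · rw [mul_smul_comm, hn]
      · rw [smul_mul_assoc, hn', smul_zero]
      · simp only at hwu
        have hun : u * n = - (n * u) := by
          have h1 := congrArg (fun x => u * x * u) hwu
          simp only [← mul_assoc, huu, one_mul] at h1
          rw [mul_assoc _ u u, huu, mul_one, mul_add, ← hwu, add_mul] at h1
          have h2 : (2 * e - 1) * u + n * u + u * n = (2 * e - 1) * u := h1
          rw [add_assoc, add_eq_left] at h2
          exact eq_neg_of_add_eq_zero_right h2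
        rw [mul_add, mul_smul_comm, hun, ← hwu, add_mul, add_mul, smul_mul_assoc]
        module
    · rintro ⟨w, hw, huw⟩
      ext x
      constructor
      · rintro ⟨v, hv, rfl⟩
        refine ⟨u * v * u, conj_mem_deltaPlus huu hw huw hv, ?_⟩
        simp only [mul_assoc, huu, mul_one]
      · rintro ⟨v, hv, rfl⟩
        refine ⟨u * v * u, conj_mem_deltaPlus huu hw huw hv, ?_⟩
        simp only [mul_assoc, involution_cancel huu]
  square := by
    rintro _ ⟨u, hu, v, hv, rfl⟩
    obtain ⟨n, hn, hn', rfl⟩ := exists_deviation he hu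
    obtain ⟨m, hm, hm', rfl⟩ := exists_deviation he hv
    rw [deviation_mul he hn' hm, add_sub_cancel_left, sq, mul_sub, sub_mul, sub_mul,
      deviation_mul_eq_zero hn' hn, deviation_mul_eq_zero hn' hm, deviation_mul_eq_zero hm' hn,
      deviation_mul_eq_zero hm' hm]
    simp

/-! ### Admissible sets and their behaviour under negation. -/

/-- The predicate whose maximal elements are studied. -/
def IsAdmissible (φ : Set R) : Prop :=
  φ.Nonempty ∧ φ ⊆ involutions R ∧ FourConditions φ

lemma isAdmissible_deltaPlus [Algebra ℚ R] {e : R} (he : IsIdempotentElem e) :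
    IsAdmissible (deltaPlus e) :=
  ⟨⟨_, self_mem_deltaPlus he⟩, deltaPlus_subset_involutions, fourConditions_deltaPlus he⟩

lemma FourConditions.neg {φ : Set R} (h : FourConditions φ) :
    FourConditions ((fun x : R => -x) '' φ) where
  triple := by
    intro u hu v hv w hw
    rw [mem_neg_image] at *
    obtain ⟨h1, h2⟩ := h.triple _ hu _ hv _ hw
    simp only [neg_mul, mul_neg, neg_neg, neg_inj] at h1 h2
    exact ⟨h1, h2⟩
  midpoint := by
    intro u hu v hv
    rw [mem_neg_image] at *
    obtain ⟨w, ⟨hw, hwv⟩, huniq⟩ := h.midpoint _ hu _ hv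
    refine ⟨-w, ⟨by simpa using hw, by simpa using congrArg Neg.neg hwv⟩, ?_⟩
    rintro x ⟨hx, hxv⟩
    rw [mem_neg_image] at hx
    rw [← huniq (-x) ⟨hx, by simpa using hxv⟩, neg_neg]
  normalise := by
    intro u hu
    have h1 : (fun w : R => u * w) '' ((fun x : R => -x) '' φ) =
        (fun x : R => -x) '' ((fun w : R => u * w) '' φ) := by
      simp only [Set.image_image, mul_neg]
    have h2 : (fun w : R => w * u) '' ((fun x : R => -x) '' φ) =
        (fun x : R => -x) '' ((fun w : R => w * u) '' φ) := by
      simp only [Set.image_image, neg_mul]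
    rw [h1, h2, (neg_injective.image_injective).eq_iff, h.normalise u hu]
    simp
  square := by
    rintro _ ⟨u, hu, v, hv, rfl⟩
    rw [mem_neg_image] at *
    have := h.square _ ⟨_, hu, _, hv, rfl⟩
    simpa using this

lemma IsAdmissible.neg {φ : Set R} (h : IsAdmissible φ) :
    IsAdmissible ((fun x : R => -x) '' φ) := by
  refine ⟨h.1.image _, ?_, h.2.2.neg⟩
  intro u hu
  rw [mem_neg_image] at hu
  have := h.2.1 hu
  simpa [involutions] using this

lemma neg_image_neg_image (φ : Set R) : (fun x : R => -x) '' ((fun x : R => -x) '' φ) = φ := by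
  simp

/-! ### Peirce relations in an admissible set. -/

lemma IsAdmissible.mul_add_mul {φ : Set R} (h : IsAdmissible φ) {u v : R} (hu : u ∈ φ)
    (hv : v ∈ φ) : u * v + v * u = 2 :=
  (mul_sub_one_sq_eq_zero_iff (mul_self_of_mem_involutions (h.2.1 hu))
    (mul_self_of_mem_involutions (h.2.1 hv))).1 (h.2.2.square _ ⟨u, hu, v, hv, rfl⟩)

lemma eq_of_two_mul_eq [Algebra ℚ R] {a b : R} (h : 2 * a = 2 * b) : a = b := by
  have := congrArg (fun x => (1 / 2 : ℚ) • x) h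
  simp only [two_mul] at this
  calc a = (1 / 2 : ℚ) • (a + a) := by module
    _ = (1 / 2 : ℚ) • (b + b) := this
    _ = b := by module

/-- The Peirce relation of a difference of two elements of an admissible set. -/
lemma IsAdmissible.peirce [Algebra ℚ R] {φ : Set R} (h : IsAdmissible φ) {e n : R}
    (hu : 2 * e - 1 ∈ φ) (hn : 2 * e - 1 + n ∈ φ) : e * n + n * e = n := by
  have h1 := h.mul_add_mul hu hu
  have h2 := h.mul_add_mul hu hn
  refine eq_of_two_mul_eq ?_
  have : (2 * e - 1) * (2 * e - 1 + n) + (2 * e - 1 + n) * (2 * e - 1) =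
    ((2 * e - 1) * (2 * e - 1) + (2 * e - 1) * (2 * e - 1)) +
      (2 * (e * n + n * e) - 2 * n) := by noncomm_ring
  rw [this, h1, add_eq_left, sub_eq_zero] at h2
  exact h2

lemma mul_mul_eq_zero_of_peirce {e n : R} (he : IsIdempotentElem e) (h : e * n + n * e = n) :
    e * n * e = 0 := by
  have h1 := congrArg (fun x => e * x) h
  simp only [mul_add, ← mul_assoc, he.eq, add_eq_left] at h1
  exact h1

/-- A deviation `k` of `ψ` anticommutes with every `n` in `eR(1 - e)`. Since `eke = 0`, the part of
`nk + kn = 0` outside `eR` is `kn = 0`. Hence `ke · R · (1 - e) = 0`, and primeness gives `ke = 0`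
or `e = 1`. -/
lemma subset_deltaPlus_of_deltaPlus_subset [Algebra ℚ R]
    (hprime : ∀ a b : R, (∀ x, a * x * b = 0) → a = 0 ∨ b = 0) {e : R}
    (he : IsIdempotentElem e) {ψ : Set R} (hψ : IsAdmissible ψ) (hsub : deltaPlus e ⊆ ψ) :
    ψ ⊆ deltaPlus e := by
  intro v hv
  obtain ⟨k, rfl⟩ : ∃ k, v = 2 * e - 1 + k := ⟨v - (2 * e - 1), by abel⟩
  have hee : e * e = e := he
  have hp := hψ.peirce (hsub (self_mem_deltaPlus he)) hv
  have heke := mul_mul_eq_zero_of_peirce he hp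
  have key : ∀ x, k * e * x * (1 - e) = 0 := by
    intro x
    obtain ⟨n, hn⟩ : ∃ n, e * x * (1 - e) = n := ⟨_, rfl⟩
    have hen : e * n = n := by rw [← hn, ← mul_assoc, ← mul_assoc, hee]
    have hne : n * e = 0 := by rw [← hn, mul_assoc, sub_mul, one_mul, hee, sub_self, mul_zero]
    have h1 := hψ.mul_add_mul (hsub (add_mem_deltaPlus he hen hne)) hv
    have h2 := hψ.mul_add_mul (hsub (self_mem_deltaPlus he)) hv
    have h3 : n * k + k * n = 0 := by
      have : (2 * e - 1 + n) * (2 * e - 1 + k) + (2 * e - 1 + k) * (2 * e - 1 + n) =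
        (2 * e - 1) * (2 * e - 1 + k) + (2 * e - 1 + k) * (2 * e - 1) +
          (n * k + k * n + 2 * (n * e) + 2 * (e * n) - 2 * n) := by noncomm_ring
      rw [this, h2, hne, hen, add_eq_left] at h1
      simpa using h1
    have hekn : e * k * n = 0 := by rw [← hen, ← mul_assoc, heke, zero_mul]
    have h4 : k * n = 0 := by
      have := congrArg (fun x => x - e * x) h3
      simpa only [mul_add, ← mul_assoc, hen, hekn, mul_zero, sub_zero, add_sub_add_left_eq_sub,
        add_zero, add_sub_cancel_left] using this
    rw [← hn] at h4
    simpa only [← mul_assoc] using h4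
  rcases hprime _ _ key with h | h
  · exact add_mem_deltaPlus he (by rwa [h, add_zero] at hp) h
  · have h1 : e = 1 := (sub_eq_zero.1 h).symm
    subst h1
    have : k = 0 := by simpa using heke
    subst this
    exact add_mem_deltaPlus he (by simp) (by simp)

/-! ### Every admissible set lies in a `Δ⁺`- or `Δ⁻`-set. -/

/-- Unipotence makes `n` and `m` anticommute with `u` and with each other, while the triple
condition with `u` in the middle makes them commute. -/
lemma IsAdmissible.deviation_mul_eq_zero [Algebra ℚ R] {φ : Set R} (h : IsAdmissible φ)
    {u n m : R} (hu : u ∈ φ) (hn : u + n ∈ φ) (hm : u + m ∈ φ) : n * m = 0 := by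
  have huu := mul_self_of_mem_involutions (h.2.1 hu)
  have h1 : u * n + n * u = 0 := by
    have h1 := h.mul_add_mul hu hn
    have : u * (u + n) + (u + n) * u = u * u + u * u + (u * n + n * u) := by noncomm_ring
    rw [this, h.mul_add_mul hu hu, add_eq_left] at h1
    exact h1
  have h2 : u * m + m * u = 0 := by
    have h1 := h.mul_add_mul hu hm
    have : u * (u + m) + (u + m) * u = u * u + u * u + (u * m + m * u) := by noncomm_ring
    rw [this, h.mul_add_mul hu hu, add_eq_left] at h1
    exact h1
  have h3 : n * m + m * n = 0 := by
    have h3 := h.mul_add_mul hn hm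
    have : (u + n) * (u + m) + (u + m) * (u + n) =
      u * u + u * u + (u * n + n * u) + (u * m + m * u) + (n * m + m * n) := by noncomm_ring
    rw [this, h.mul_add_mul hu hu, h1, h2, add_zero, add_zero, add_eq_left] at h3
    exact h3
  have h4 : n * u * m = m * u * n := by
    have h4 := (h.2.2.triple _ hn _ hu _ hm).1
    have e1 : (u + n) * u * (u + m) = u * u * u + n * (u * u) + u * u * m + n * u * m := by
      noncomm_ring
    have e2 : (u + m) * u * (u + n) = u * u * u + m * (u * u) + u * u * n + m * u * n := by
      noncomm_ring
    rw [e1, e2, huu] at h4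
    simp only [one_mul, mul_one] at h4
    rwa [add_right_comm u, add_right_inj] at h4
  have h5 : n * m = m * n := by
    rw [eq_neg_of_add_eq_zero_right h1, eq_neg_of_add_eq_zero_right h2] at h4
    have := congrArg (fun x => u * x) h4
    simpa only [neg_mul, mul_neg, mul_assoc, involution_cancel huu, neg_inj] using this
  rw [← h5, ← two_mul] at h3
  exact eq_of_two_mul_eq (by rw [h3, mul_zero])

lemma IsAdmissible.conj_mem {φ : Set R} (h : IsAdmissible φ) {s u v : R} (hs : s * s = 1)
    (hu : u ∈ φ) (hsu : s * u = u * s) (hv : v ∈ φ) : s * v * s ∈ φ := by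
  have h1 := (h.2.2.normalise s (by change s ^ 2 = 1; rw [sq, hs])).2 ⟨u, hu, hsu⟩
  have h2 : s * v ∈ (fun w : R => w * s) '' φ := h1 ▸ ⟨v, hv, rfl⟩
  obtain ⟨w, hw, hws⟩ := h2
  simp only at hws
  rwa [← hws, mul_assoc, hs, mul_one]

/-- Conjugating by the involution `1 - 2 * g` for an idempotent `g` below `1 - e`. -/
lemma IsAdmissible.deviation_mul_idempotent_mul [Algebra ℚ R] {φ : Set R} (h : IsAdmissible φ)
    {e g n m : R} (hu : 2 * e - 1 ∈ φ) (hn : 2 * e - 1 + n ∈ φ)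
    (hm : 2 * e - 1 + m ∈ φ) (hg : g * g = g) (heg : e * g = 0) (hge : g * e = 0) :
    n * g * m = 0 := by
  have hs : (1 - 2 * g) * (1 - 2 * g) = 1 := by
    have : (1 - 2 * g) * (1 - 2 * g) = 1 - 4 * g + 4 * (g * g) := by noncomm_ring
    rw [this, hg]; noncomm_ring
  have hc : (1 - 2 * g) * (2 * e - 1) = (2 * e - 1) * (1 - 2 * g) := by
    have e1 : (1 - 2 * g) * (2 * e - 1) = 2 * e - 1 - 4 * (g * e) + 2 * g := by noncomm_ring
    have e2 : (2 * e - 1) * (1 - 2 * g) = 2 * e - 1 - 4 * (e * g) + 2 * g := by noncomm_ring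
    rw [e1, e2, heg, hge]
  have hconj := h.conj_mem hs hu hc hm
  have hgmg : g * m * g = 0 := by
    rw [← h.peirce hu hm, mul_add, add_mul, ← mul_assoc, hge, mul_assoc g (m * e), mul_assoc m,
      heg]
    simp
  have e3 : (1 - 2 * g) * (2 * e - 1 + m) * (1 - 2 * g) =
      2 * e - 1 + (m - 2 * (g * m) - 2 * (m * g)) := by
    have : (1 - 2 * g) * (2 * e - 1 + m) * (1 - 2 * g) =
      (1 - 2 * g) * (2 * e - 1) * (1 - 2 * g) + (m - 2 * (g * m) - 2 * (m * g)) +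
        4 * (g * m * g) := by noncomm_ring
    rw [this, hgmg, hc, mul_assoc, hs, mul_one, mul_zero, add_zero]
  rw [e3] at hconj
  -- Both `m` and its conjugate `m - 2gm - 2mg` are deviations, so `n` annihilates both; only `n g
  -- m` survives in the difference.
  have h1 := h.deviation_mul_eq_zero hu hn hconj
  have hnm := h.deviation_mul_eq_zero hu hn hm
  have e4 : n * (m - 2 * (g * m) - 2 * (m * g)) =
    n * m - 2 * (n * g * m) - 2 * (n * m * g) := by noncomm_ring
  rw [e4, hnm, zero_mul, mul_zero, sub_zero, zero_sub, neg_eq_zero] at h1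
  exact eq_of_two_mul_eq (by rw [h1, mul_zero])

/-- By primeness it is enough that `(en)x(me) = 0` for all `x`. This is read off from `n g m = 0` by
choosing idempotents `g` below `1 - e` that depend linearly on `x`. -/
lemma IsAdmissible.left_or_right [Algebra ℚ R]
    (hprime : ∀ a b : R, (∀ x, a * x * b = 0) → a = 0 ∨ b = 0)
    (hrange : ∀ c : R, ∃ f, f * f = f ∧ f * c = c ∧ ∀ b, b * c = 0 → b * f = 0)
    {φ : Set R} (h : IsAdmissible φ) {e n m : R} (he : IsIdempotentElem e)
    (hu : 2 * e - 1 ∈ φ) (hn : 2 * e - 1 + n ∈ φ) (hm : 2 * e - 1 + m ∈ φ) :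
    e * n = 0 ∨ m * e = 0 := by
  have hee : e * e = e := he
  obtain ⟨f, hf, hfc, hfb⟩ := hrange (m * e)
  have hef : e * f = 0 := hfb _ (by
    rw [← mul_assoc]; exact mul_mul_eq_zero_of_peirce he (h.peirce hu hm))
  have hbf : n * f = 0 := hfb _ (by
    rw [← mul_assoc, h.deviation_mul_eq_zero hu hn hm, zero_mul])
  have hene := mul_mul_eq_zero_of_peirce he (h.peirce hu hn)
  have heme := mul_mul_eq_zero_of_peirce he (h.peirce hu hm)
  refine hprime _ _ fun x => ?_
  -- The range idempotent `f` of `me` satisfies `ef = 0`, but `fe` may be nonzero. The factor `1 -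
  -- e` makes `p` orthogonal to `e` on both sides while keeping `p(me) = me` and `np = 0`.
  obtain ⟨p, hp⟩ : ∃ p, f * (1 - e) = p := ⟨_, rfl⟩
  have hep : e * p = 0 := by rw [← hp, ← mul_assoc, hef, zero_mul]
  have hpe : p * e = 0 := by rw [← hp, mul_assoc, sub_mul, one_mul, hee, sub_self, mul_zero]
  have hpp : p * p = p := by
    nth_rw 2 [← hp]
    have : p * (f * (1 - e)) = f * f * (1 - e) - f * (e * f) * (1 - e) := by
      rw [← hp]; noncomm_ring
    rw [this, hf, hef, hp]; simp
  have hpm : p * (m * e) = m * e := by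
    have : p * (m * e) = f * (m * e) - f * (e * m * e) := by rw [← hp]; noncomm_ring
    rw [this, hfc, heme, mul_zero, sub_zero]
  have hnp : n * p = 0 := by rw [← hp, ← mul_assoc, hbf, zero_mul]
  -- Adding an element of `(1 - e - p)Rp` to `p` keeps it idempotent and below `1 - e`. In `e(ngm)e`
  -- the identities `np = 0`, `p(me) = me` and `ene = 0` leave only `(en)x(me)`.
  have hg := h.deviation_mul_idempotent_mul (g := p + (1 - e - p) * x * p) hu hn hm ?_ ?_ ?_
  · have h1 := congrArg (fun y => e * y * e) hg
    have e1 : e * (n * (p + (1 - e - p) * x * p) * m) * e =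
      e * (n * p) * m * e + e * n * x * (p * (m * e)) - e * n * e * x * (p * (m * e))
        - e * (n * p) * x * (p * (m * e)) := by noncomm_ring
    simp only [e1, hnp, hpm, hene, mul_zero, zero_mul, sub_zero, zero_add] at h1
    exact h1
  · have e1 : (p + (1 - e - p) * x * p) * (p + (1 - e - p) * x * p) =
      p * p + (p - p * e - p * p) * x * p + (1 - e - p) * x * (p * p) +
        (1 - e - p) * x * (p - p * e - p * p) * x * p := by noncomm_ring
    rw [e1, hpp, hpe]; simp
  · have e1 : e * (p + (1 - e - p) * x * p) = e * p + (e - e * e - e * p) * x * p := by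
      noncomm_ring
    rw [e1, hep, hee]; simp
  · have e1 : (p + (1 - e - p) * x * p) * e = p * e + (1 - e - p) * x * (p * e) := by
      noncomm_ring
    rw [e1, hpe]; simp

lemma IsAdmissible.exists_subset [Algebra ℚ R]
    (hprime : ∀ a b : R, (∀ x, a * x * b = 0) → a = 0 ∨ b = 0)
    (hrange : ∀ c : R, ∃ f, f * f = f ∧ f * c = c ∧ ∀ b, b * c = 0 → b * f = 0)
    {φ : Set R} (h : IsAdmissible φ) :
    ∃ e : R, IsIdempotentElem e ∧ (φ ⊆ deltaPlus e ∨ φ ⊆ deltaMinus e) := by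
  obtain ⟨u, hu⟩ := h.1
  have huu := mul_self_of_mem_involutions (h.2.1 hu)
  obtain ⟨e, he, rfl⟩ : ∃ e : R, IsIdempotentElem e ∧ u = 2 * e - 1 := by
    refine ⟨(1 / 2 : ℚ) • (u + 1), ?_, ?_⟩
    · change (1 / 2 : ℚ) • (u + 1) * (1 / 2 : ℚ) • (u + 1) = _
      rw [smul_mul_assoc, mul_smul_comm, mul_add, add_mul, add_mul, huu]
      simp only [one_mul, mul_one]
      module
    · rw [two_mul]; module
  by_cases hall : ∀ m, 2 * e - 1 + m ∈ φ → m * e = 0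
  · refine ⟨e, he, Or.inl fun v hv => ?_⟩
    obtain ⟨k, rfl⟩ : ∃ k, v = 2 * e - 1 + k := ⟨v - (2 * e - 1), by abel⟩
    have hk := hall k hv
    have hp := h.peirce hu hv
    rw [hk, add_zero] at hp
    exact add_mem_deltaPlus he hp hk
  · push Not at hall
    obtain ⟨m, hm, hme⟩ := hall
    -- One deviation with `me ≠ 0` forces `ek = 0` for every deviation `k`; then `-v` has deviation
    -- `-k` from `2(1 - e) - 1`, lying in `(1 - e)Re`.
    refine ⟨1 - e, he.one_sub, Or.inr fun v hv => ?_⟩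
    obtain ⟨k, rfl⟩ : ∃ k, v = 2 * e - 1 + k := ⟨v - (2 * e - 1), by abel⟩
    have hk := (h.left_or_right hprime hrange he hu hv hm).resolve_right hme
    have hp := h.peirce hu hv
    rw [hk, zero_add] at hp
    rw [deltaMinus, mem_neg_image]
    have : -(2 * e - 1 + k) = 2 * (1 - e) - 1 + -k := by noncomm_ring
    rw [this]
    refine add_mem_deltaPlus he.one_sub ?_ ?_
    · rw [sub_mul, one_mul, mul_neg, hk]; simp
    · rw [mul_sub, mul_one, neg_mul, hp, sub_self]

theorem isDeltaSet_iff_maximal [Algebra ℚ R]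
    (hprime : ∀ a b : R, (∀ x, a * x * b = 0) → a = 0 ∨ b = 0)
    (hrange : ∀ c : R, ∃ f, f * f = f ∧ f * c = c ∧ ∀ b, b * c = 0 → b * f = 0)
    (φ : Set R) :
    (IsDeltaPlusSet φ ∨ IsDeltaMinusSet φ) ↔ Maximal IsAdmissible φ := by
  constructor
  · rintro (⟨e, he, rfl⟩ | ⟨e, he, rfl⟩)
    · exact ⟨isAdmissible_deltaPlus he, fun ψ hψ hsub =>
        subset_deltaPlus_of_deltaPlus_subset hprime he hψ hsub⟩
    · refine ⟨(isAdmissible_deltaPlus he).neg, fun ψ hψ hsub => ?_⟩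
      have h1 := subset_deltaPlus_of_deltaPlus_subset hprime he hψ.neg (by
        rw [← neg_image_neg_image (deltaPlus e)]
        exact Set.image_mono hsub)
      rw [← neg_image_neg_image ψ]
      exact Set.image_mono h1
  · intro h
    obtain ⟨e, he, hs | hs⟩ := h.prop.exists_subset hprime hrange
    · exact Or.inl ⟨e, he, h.eq_of_subset (isAdmissible_deltaPlus he) hs⟩
    · exact Or.inr ⟨e, he, h.eq_of_subset (isAdmissible_deltaPlus he).neg hs⟩

end Abstract

end DeltaSets

/-! ### Primeness of factors and range projections. -/

namespace VonNeumannAlgebra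

variable {H : Type*} [NormedAddCommGroup H] [InnerProductSpace ℂ H]

/-- An operator that maps a set into itself also preserves the closed span of the set. -/
lemma map_mem_closure_span (y : H →L[ℂ] H) {s : Set H} (h : ∀ x ∈ s, y x ∈ s) :
    ∀ x ∈ (Submodule.span ℂ s).topologicalClosure,
      y x ∈ (Submodule.span ℂ s).topologicalClosure := by
  intro x hx
  refine map_mem_closure y.continuous hx fun z hz => ?_
  have : Submodule.span ℂ s ≤ (Submodule.span ℂ s).comap (y : H →ₗ[ℂ] H) :=
    Submodule.span_le.2 fun w hw => Submodule.subset_span (h w hw)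
  exact this hz

/-- An operator that vanishes on a set also vanishes on its closed span. -/
lemma map_eq_zero_of_mem_closure_span (y : H →L[ℂ] H) {s : Set H} (h : ∀ x ∈ s, y x = 0) :
    ∀ x ∈ (Submodule.span ℂ s).topologicalClosure, y x = 0 := by
  have h1 : (Submodule.span ℂ s).topologicalClosure ≤ LinearMap.ker (y : H →ₗ[ℂ] H) :=
    Submodule.topologicalClosure_minimal _ (Submodule.span_le.2 h) y.isClosed_ker
  exact fun x hx => h1 hx

variable [CompleteSpace H]

/-- The commutant is self-adjoint, so invariance of `K` passes to its orthogonal complement; the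
projection then commutes with `N.commutant` and lies in the bicommutant. -/
lemma starProjection_mem_iff (N : VonNeumannAlgebra H) (K : Submodule ℂ H)
    [K.HasOrthogonalProjection] :
    K.starProjection ∈ N ↔ ∀ y ∈ N.commutant, ∀ x ∈ K, y x ∈ K := by
  rw [IsStarProjection.mem_iff isStarProjection_starProjection]
  simp only [Submodule.range_starProjection, Module.End.mem_invtSubmodule_iff_forall_mem_of_mem]
  rfl

/-- The closed span `K` of `N b H` is invariant under both `N` and its commutant, so its projection
is central, hence a scalar. Either `K` is zero and `b = 0`, or `K` is all of `H`, where `a`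
vanishes. -/
lemma IsFactor.eq_zero_or_eq_zero {N : VonNeumannAlgebra H} (hN : N.IsFactor) (a b : N)
    (h : ∀ x, a * x * b = 0) : a = 0 ∨ b = 0 := by
  let s : Set H := {ξ | ∃ x ∈ N, ∃ η, x ((b : H →L[ℂ] H) η) = ξ}
  let K := (Submodule.span ℂ s).topologicalClosure
  have : CompleteSpace K := (Submodule.isClosed_topologicalClosure _).completeSpace_coe
  have hb : ∀ η, (b : H →L[ℂ] H) η ∈ K := fun η =>
    Submodule.le_topologicalClosure _ (Submodule.subset_span ⟨1, one_mem N, η, rfl⟩)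
  have ha : ∀ ξ ∈ K, (a : H →L[ℂ] H) ξ = 0 := by
    refine map_eq_zero_of_mem_closure_span _ ?_
    rintro _ ⟨x, hx, η, rfl⟩
    exact congrArg (fun t : N => (t : H →L[ℂ] H) η) (h ⟨x, hx⟩)
  have h1 : K.starProjection ∈ N := by
    rw [starProjection_mem_iff]
    intro y hy
    refine map_mem_closure_span y ?_
    rintro _ ⟨x, hx, η, rfl⟩
    rw [mem_commutant_iff] at hy
    refine ⟨x, hx, y η, ?_⟩
    have e1 := congrArg (fun t => x (t η)) (hy b b.2)
    have e2 := congrArg (fun t => t ((b : H →L[ℂ] H) η)) (hy x hx)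
    exact e1.trans e2
  have h2 : K.starProjection ∈ N.commutant := by
    rw [starProjection_mem_iff, commutant_commutant]
    intro y hy
    refine map_mem_closure_span y ?_
    rintro _ ⟨x, hx, η, rfl⟩
    exact ⟨y * x, mul_mem hy hx, η, rfl⟩
  obtain ⟨c, hc⟩ := hN _ h1 h2
  by_cases hc0 : c = 0
  · right
    ext η
    have := (Submodule.starProjection_eq_self_iff (K := K)).2 (hb η)
    rw [hc, hc0, zero_smul] at this
    exact this.symm
  · left
    ext η
    have h3 : K.starProjection η = c • η := by rw [hc]; rfl
    have h4 : c • η ∈ K := h3 ▸ Submodule.starProjection_apply_mem K η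
    exact ha _ ((Submodule.smul_mem_iff K hc0).1 h4)

/-- The witness is the projection onto the closure of the range of `c`, which is invariant under the
commutant. -/
lemma exists_range_idempotent (N : VonNeumannAlgebra H) (c : N) :
    ∃ f : N, f * f = f ∧ f * c = c ∧ ∀ b : N, b * c = 0 → b * f = 0 := by
  let s : Set H := Set.range (c : H →L[ℂ] H)
  let K := (Submodule.span ℂ s).topologicalClosure
  have : CompleteSpace K := (Submodule.isClosed_topologicalClosure _).completeSpace_coe
  have h1 : K.starProjection ∈ N := by
    rw [starProjection_mem_iff]
    intro y hy
    refine map_mem_closure_span y ?_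
    rintro _ ⟨η, rfl⟩
    rw [mem_commutant_iff] at hy
    exact ⟨y η, congrArg (fun t => t η) (hy c c.2)⟩
  refine ⟨⟨_, h1⟩, Subtype.ext K.isIdempotentElem_starProjection, ?_, ?_⟩
  · ext η
    exact Submodule.starProjection_eq_self_iff.2
      (Submodule.le_topologicalClosure _ (Submodule.subset_span ⟨η, rfl⟩))
  · intro b hb
    ext η
    refine map_eq_zero_of_mem_closure_span (b : H →L[ℂ] H) (s := s) ?_ _
      (Submodule.starProjection_apply_mem K η)
    rintro _ ⟨ξ, rfl⟩
    exact congrArg (fun t : N => (t : H →L[ℂ] H) ξ) hb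

end VonNeumannAlgebra

theorem theoremB {H : Type*} [NormedAddCommGroup H] [InnerProductSpace ℂ H] [CompleteSpace H]
    (N : VonNeumannAlgebra H) (hN : N.IsFactor)
    (φ : Set N) (hne : φ.Nonempty) (hinv : φ ⊆ DeltaSets.involutions N) :
    (DeltaSets.IsDeltaPlusSet φ ∨ DeltaSets.IsDeltaMinusSet φ) ↔
      Maximal (fun ψ : Set N =>
        ψ.Nonempty ∧ ψ ⊆ DeltaSets.involutions N ∧ DeltaSets.FourConditions ψ) φ := by
  let _ : Algebra ℂ N := inferInstanceAs (Algebra ℂ N.toStarSubalgebra)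
  let _ : Algebra ℚ N := Algebra.compHom N (algebraMap ℚ ℂ)
  exact DeltaSets.isDeltaSet_iff_maximal hN.eq_zero_or_eq_zero N.exists_range_idempotent φ
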